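/- Fix a universal prefix-free machine $U$: a partial computable function $(\tau,y)\mapsto U(\tau,y)$ on pairs of finite binary strings such that, for each $y$, no halting program $\tau$ is a proper prefix of another halting program, and such that for every machine $M$ with these properties there is a constant $k$ for which $M(\tau,y)=x$ implies $U(\tau',y)=x$ for some $\tau'$ with $|\tau'|\le|\tau|+k$. Let $K(x\mid y):=\min\{|\tau| : U(\tau,y)=x\}$. Fix an injective encoding $\mathrm{code}:\mathbb{N}\to\{0,1\}^*$ with $|\mathrm{code}(n)|=\log_2 n+O(1)$ for $n\ge 1$. Fix also any map $X\mapsto\langle X\rangle$ assigning to each real number $X$ a finite binary string by which $X$ is presented to $U$ (for integers $X$, for instance, $\langle X\rangle=\mathrm{code}(X)$), and write $K(x\mid X):=K(x\mid\langle X\rangle)$. For a prime $p$ let $g(p)=p'-p$, where $p'$ is the least prime greater than $p$. **Theorem.** Let $c\in(0,1)$ and $\delta\in(0,1)$. Then there exists $X_0$ such that for all real $X\ge X_0$, $$\frac{\#\{p\in[X,2X]\ \text{prime} : K(\mathrm{code}(g(p))\mid X)\ge c\log_2\log_2 X\}}{\#\{p\in[X,2X]\ \text{prime}\}}\ \ge\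 1-\delta .$$ -/

import Mathlib

/-- A (conditional) prefix-free machine, identified with the partial function it computes:
`U p y` is the output on program `p` with the conditional string `y`. It is partial computable,
and for every fixed condition `y` no halting program is a proper prefix of another one. -/
structure IsPrefixFreeMachine (U : List Bool → List Bool →. List Bool) : Prop where
  partrec : Partrec₂ U
  prefixFree : ∀ y p q : List Bool, (U p y).Dom → (U q y).Dom → p <+: q → p = q

/-- A universal prefix-free machine: a prefix-free machine which simulates every prefix-free
machine `M` with programs that are longer by at most a constant depending only on `M`. -/
structure IsUniversalPrefixFreeMachine (U : List Bool → List Bool →. List Bool) : Prop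
    extends IsPrefixFreeMachine U where
  universal : ∀ M : List Bool → List Bool →. List Bool, IsPrefixFreeMachine M →
    ∃ k : ℕ, ∀ p y x : List Bool, x ∈ M p y → ∃ q : List Bool, q.length ≤ p.length + k ∧ x ∈ U q y

/-- The conditional Kolmogorov complexity `K(x | y)` with respect to the machine `U`: the least
length of a program `p` with `U p y = x`. -/
noncomputable def condKolmogorov (U : List Bool → List Bool →. List Bool) (x y : List Bool) : ℕ :=
  sInf {n : ℕ | ∃ p : List Bool, p.length = n ∧ x ∈ U p y}

/-- For a universal machine the infimum in `condKolmogorov` is over a non-empty set, so it is a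
minimum. -/
theorem IsUniversalPrefixFreeMachine.exists_program {U : List Bool → List Bool →. List Bool}
    (hU : IsUniversalPrefixFreeMachine U) (x y : List Bool) :
    ∃ p : List Bool, p.length = condKolmogorov U x y ∧ x ∈ U p y := by
  let M : List Bool → List Bool →. List Bool :=
    fun p _ => ((bif p.isEmpty then some x else none : Option (List Bool)) : Part (List Bool))
  have hM : IsPrefixFreeMachine M := by
    refine ⟨?_, ?_⟩
    · have h1 : Computable (fun a : List Bool × List Bool => a.1.isEmpty) := by
        have h2 : Primrec (fun a : List Bool × List Bool => decide (a.1.length = 0)) :=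
          (PrimrecRel.comp Primrec.eq (Primrec.list_length.comp Primrec.fst)
            (Primrec.const 0)).decide
        refine h2.to_comp.of_eq fun a => ?_
        cases a.1 <;> simp
      have h3 : Computable (fun a : List Bool × List Bool =>
          (bif a.1.isEmpty then some x else none : Option (List Bool))) :=
        Computable.cond h1 (Computable.const _) (Computable.const _)
      exact h3.ofOption
    · intro y p q hp hq _
      cases p <;> cases q <;> simp_all [M]
  obtain ⟨k, hk⟩ := hU.universal M hM
  obtain ⟨q, _, hq⟩ := hk [] y x (by simp [M])
  exact Nat.sInf_mem (s := {n : ℕ | ∃ p : List Bool, p.length = n ∧ x ∈ U p y}) ⟨_, q, rfl, hq⟩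

/-- An encoding of the natural numbers by binary strings with `|code n| = log₂ n + O(1)`. -/
structure IsIntegerEncoding (code : ℕ → List Bool) : Prop where
  injective : Function.Injective code
  length_eq : ∃ C : ℝ, ∀ n : ℕ, 1 ≤ n → |((code n).length : ℝ) - Real.logb 2 n| ≤ C

/-- The gap `g(p) = p' - p`, where `p'` is the least prime greater than `p`. -/
noncomputable def primeGap (p : ℕ) : ℕ := sInf {q : ℕ | q.Prime ∧ p < q} - p

/-- The (finite) set of primes in the dyadic interval `[X, 2X]`. -/
def dyadicPrimes (X : ℝ) : Set ℕ := {p : ℕ | p.Prime ∧ X ≤ (p : ℝ) ∧ (p : ℝ) ≤ 2 * X}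

/-! Write `Y = log X`, and let `k` be the ceiling of `c log₂ log₂ X`. For a fixed condition, fewer
than `2 ^ k` strings have programs shorter than `k`; since the encoding of integers is injective, at
most `4 Y ^ c` of the gap values considered are simple. This count is uniform in the condition, so
the way `X` is presented to the machine plays no role.

It remains to show that no few gap values can absorb many primes. For each `d` up to a fixed power
of `Y`, Brun's pure sieve gives `O(X (log Y) ^ 18 / Y ^ 2)` primes `p` in `[X, 2X]` with `p + d`
prime (`eventually_card_prime_pairs_le`). Larger gaps are rare because the gaps sum to `O(X)`
(`sum_primeGap_le`). The exceptional primes thus number `O(X Y ^ (c - 2) (log Y) ^ 18 + X / Y ^ 2)`,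
which is `o(X / Y)` because `c < 1`, while Chebyshev's bound gives at least `X / (16 Y)` primes in
all.

Powers of `log Y` are harmless, which permits two economies. The sieve uses only primes exceeding
`d`, so no singular series appears, and the Mertens-type estimates may have poor constants. -/

/-! ### Brun's pure sieve in abstract form. -/

/-- **Bonferroni inequalities**, weighted form: truncating the expansion of `∏ (1 - a i)` at sets of
size less than `k` gives a lower bound for even `k` and an upper bound for odd `k`. -/
theorem bonferroni_prod {ι : Type*} [DecidableEq ι] (a : ι → ℝ) (P : Finset ι)
    (h0 : ∀ i ∈ P, 0 ≤ a i) (h1 : ∀ i ∈ P, a i ≤ 1) (k : ℕ) :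
    0 ≤ (-1) ^ k * (∏ i ∈ P, (1 - a i) -
      ∑ S ∈ P.powerset, if S.card < k then ∏ i ∈ S, (-a i) else 0) := by
  induction P using Finset.induction_on generalizing k with
  | empty =>
    cases k <;> simp
  | insert q P hq ih =>
    have h0' : ∀ i ∈ P, 0 ≤ a i := fun i hi => h0 i (Finset.mem_insert_of_mem hi)
    have h1' : ∀ i ∈ P, a i ≤ 1 := fun i hi => h1 i (Finset.mem_insert_of_mem hi)
    cases k with
    | zero =>
      simp only [pow_zero, Nat.not_lt_zero, if_false, Finset.sum_const_zero, sub_zero, one_mul]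
      exact Finset.prod_nonneg fun i hi => sub_nonneg.2 (h1 i hi)
    | succ k =>
      have e1 := ih h0' h1' (k + 1)
      have e2 := mul_nonneg (h0 q (Finset.mem_insert_self _ _)) (ih h0' h1' k)
      have key : (∑ S ∈ P.powerset, if (insert q S).card < k + 1 then ∏ i ∈ insert q S, (-a i)
          else 0) = -a q * ∑ S ∈ P.powerset, if S.card < k then ∏ i ∈ S, (-a i) else 0 := by
        rw [Finset.mul_sum]
        refine Finset.sum_congr rfl fun S hS => ?_
        have hqS : q ∉ S := fun h => hq (Finset.mem_powerset.1 hS h)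
        rw [Finset.card_insert_of_notMem hqS, Finset.prod_insert hqS]
        simp only [Nat.add_lt_add_iff_right, mul_ite, mul_zero]
      -- If `E k P` denotes the truncation error, then `E (k+1) (insert q P) = E (k+1) P - a q * E k
      -- P`. The sign `(-1) ^ (k+1)` turns this into a sum of two nonnegative terms.
      rw [Finset.sum_powerset_insert hq, Finset.prod_insert hq, key]
      rw [pow_succ] at e1 ⊢
      nlinarith

/-- Rankin's bound for elementary symmetric functions. -/
theorem sum_prod_card_eq_le_exp {ι : Type*} [DecidableEq ι] (a : ι → ℝ) (P : Finset ι)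
    (h0 : ∀ i ∈ P, 0 ≤ a i) (k : ℕ) :
    (∑ S ∈ P.powerset, if S.card = k then ∏ i ∈ S, a i else 0) ≤
      Real.exp (Real.exp 1 * ∑ i ∈ P, a i - k) := by
  -- Weighting each element by `e` gives every set of size `k` the weight `e ^ k`, and the full sum
  -- factors.
  have h : ∏ i ∈ P, (1 + Real.exp 1 * a i) =
      ∑ S ∈ P.powerset, Real.exp 1 ^ S.card * ∏ i ∈ S, a i := by
    rw [Finset.prod_one_add]
    simp [Finset.prod_mul_distrib]
  have h2 : Real.exp k * (∑ S ∈ P.powerset, if S.card = k then ∏ i ∈ S, a i else 0) ≤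
      ∏ i ∈ P, (1 + Real.exp 1 * a i) := by
    rw [h, Finset.mul_sum]
    refine Finset.sum_le_sum fun S hS => ?_
    have : 0 ≤ ∏ i ∈ S, a i := Finset.prod_nonneg fun i hi => h0 i (Finset.mem_powerset.1 hS hi)
    split_ifs with hk
    · rw [hk, ← Real.exp_nat_mul, mul_one]
    · rw [mul_zero]; positivity
  have h3 : ∏ i ∈ P, (1 + Real.exp 1 * a i) ≤ Real.exp (Real.exp 1 * ∑ i ∈ P, a i) := by
    rw [Finset.mul_sum, Real.exp_sum]
    refine Finset.prod_le_prod (fun i hi => ?_) fun i _ => ?_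
    · have := h0 i hi
      positivity
    · rw [add_comm]; exact Real.add_one_le_exp _
  rw [Real.exp_sub, le_div_iff₀ (Real.exp_pos _), mul_comm]
  exact h2.trans h3

/-- Rankin's trick again: `2 ^ |S| ≤ z ^ k (2 / z) ^ |S|` when `|S| ≤ k`, and the sum over all `S`
is `(1 + 2 / z) ^ |P| ≤ e ^ 2`. This controls the accumulated sieve remainder. -/
theorem sum_two_pow_card_le {ι : Type*} [DecidableEq ι] (P : Finset ι) {z : ℝ} (hz : 1 ≤ z)
    (hP : (P.card : ℝ) ≤ z) (k : ℕ) :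
    (∑ S ∈ P.powerset, if S.card < k + 1 then (2 : ℝ) ^ S.card else 0) ≤ z ^ k * Real.exp 2 := by
  have hz0 : 0 < z := by linarith
  have h : ∏ _i ∈ P, (1 + 2 / z) = ∑ S ∈ P.powerset, (2 / z) ^ S.card := by
    simp only [Finset.prod_one_add, Finset.prod_const]
  have h3 : ∏ _i ∈ P, (1 + 2 / z) ≤ Real.exp 2 := by
    rw [Finset.prod_const]
    calc (1 + 2 / z) ^ P.card ≤ Real.exp (2 / z) ^ P.card := by
          gcongr; rw [add_comm]; exact Real.add_one_le_exp _
      _ = Real.exp (P.card * (2 / z)) := by rw [← Real.exp_nat_mul]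
      _ ≤ Real.exp 2 := by
          gcongr
          rw [← mul_div_assoc, div_le_iff₀ hz0]; linarith
  calc _ ≤ z ^ k * ∏ _i ∈ P, (1 + 2 / z) := by
        rw [h, Finset.mul_sum]
        refine Finset.sum_le_sum fun S _ => ?_
        split_ifs with hk
        · rw [div_pow, mul_div_assoc', le_div_iff₀ (by positivity), mul_comm]
          have : S.card ≤ k := by omega
          gcongr
        · positivity
    _ ≤ _ := by gcongr

/-- **Brun's pure sieve**, upper bound. -/
theorem brun_sieve_upper {ι α : Type*} [DecidableEq ι] (A : Finset α) (P : Finset ι)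
    (B : ι → α → Prop) [∀ i n, Decidable (B i n)] (g : ι → ℝ) (H z : ℝ) (hH : 0 ≤ H)
    (hz : 1 ≤ z) (hP : (P.card : ℝ) ≤ z)
    (g0 : ∀ i ∈ P, 0 ≤ g i) (g1 : ∀ i ∈ P, g i ≤ 1)
    (hA : ∀ S ⊆ P, |((A.filter fun n => ∀ i ∈ S, B i n).card : ℝ) - H * ∏ i ∈ S, g i| ≤
      2 ^ S.card) (r : ℕ) :
    ((A.filter fun n => ∀ i ∈ P, ¬ B i n).card : ℝ) ≤
      H * (∏ i ∈ P, (1 - g i) + Real.exp (Real.exp 1 * ∑ i ∈ P, g i - (2 * r : ℕ))) +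
        z ^ (2 * r) * Real.exp 2 := by
  let b : ι → α → ℝ := fun i n => if B i n then 1 else 0
  have hb : ∀ (S : Finset ι) n, ∏ i ∈ S, b i n = if ∀ i ∈ S, B i n then 1 else 0 := fun S n => by
    simp [b, Finset.prod_ite_zero]
  have hb' : ∀ n, ∏ i ∈ P, (1 - b i n) = if ∀ i ∈ P, ¬ B i n then 1 else 0 := fun n => by
    have : ∀ i, 1 - b i n = if ¬ B i n then 1 else 0 := fun i => by
      by_cases h : B i n <;> simp [b, h]
    simp only [this, Finset.prod_ite_zero, Finset.prod_const_one]
  have s1 : ((A.filter fun n => ∀ i ∈ P, ¬ B i n).card : ℝ) ≤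
      ∑ n ∈ A, ∑ S ∈ P.powerset, if S.card < 2 * r + 1 then ∏ i ∈ S, (-b i n) else 0 := by
    rw [Finset.card_filter]
    push_cast
    refine Finset.sum_le_sum fun n _ => ?_
    have := bonferroni_prod (fun i => b i n) P (fun i _ => by simp only [b]; split_ifs <;> simp)
      (fun i _ => by simp only [b]; split_ifs <;> simp) (2 * r + 1)
    rw [pow_succ, pow_mul, hb'] at this
    norm_num at this ⊢
    linarith
  have s2 : (∑ n ∈ A, ∑ S ∈ P.powerset, if S.card < 2 * r + 1 then ∏ i ∈ S, (-b i n) else 0) =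
      ∑ S ∈ P.powerset, if S.card < 2 * r + 1 then
        (-1) ^ S.card * ((A.filter fun n => ∀ i ∈ S, B i n).card : ℝ) else 0 := by
    rw [Finset.sum_comm]
    refine Finset.sum_congr rfl fun S _ => ?_
    split_ifs with h
    · rw [Finset.card_filter]
      push_cast
      rw [Finset.mul_sum]
      refine Finset.sum_congr rfl fun n _ => ?_
      rw [Finset.prod_neg, hb]
    · simp
  have s3 : (∑ S ∈ P.powerset, if S.card < 2 * r + 1 then
        (-1) ^ S.card * ((A.filter fun n => ∀ i ∈ S, B i n).card : ℝ) else 0) ≤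
      ∑ S ∈ P.powerset, ((if S.card < 2 * r + 1 then H * ∏ i ∈ S, (-g i) else 0) +
        if S.card < 2 * r + 1 then (2 : ℝ) ^ S.card else 0) := by
    refine Finset.sum_le_sum fun S hS => ?_
    split_ifs with h
    · rw [Finset.prod_neg]
      have h1 := hA S (Finset.mem_powerset.1 hS)
      rw [abs_le] at h1
      rcases neg_one_pow_eq_or ℝ S.card with h2 | h2 <;> rw [h2] <;> linarith
    · simp
  have s4 : (∑ S ∈ P.powerset, if S.card < 2 * r + 1 then H * ∏ i ∈ S, (-g i) else 0) ≤
      H * (∏ i ∈ P, (1 - g i) + Real.exp (Real.exp 1 * ∑ i ∈ P, g i - (2 * r : ℕ))) := by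
    -- Stopping the main term one level earlier, at an even level, bounds it above by the full
    -- product. The sets of size exactly `2 * r` enter with sign `+` and are left to Rankin's bound.
    have e1 := bonferroni_prod g P g0 g1 (2 * r)
    have e2 := sum_prod_card_eq_le_exp g P g0 (2 * r)
    rw [pow_mul] at e1
    norm_num at e1
    have e3 : ∀ S ∈ P.powerset, (if S.card < 2 * r + 1 then H * ∏ i ∈ S, (-g i) else 0) =
        H * ((if S.card < 2 * r then ∏ i ∈ S, (-g i) else 0) +
          if S.card = 2 * r then ∏ i ∈ S, g i else 0) := by
      intro S _
      rcases lt_trichotomy S.card (2 * r) with h | h | h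
      · simp [h, h.ne, h.trans (Nat.lt_succ_self _)]
      · simp [h, Finset.prod_neg]
      · have h' : ¬ S.card < 2 * r + 1 := by omega
        simp [h.not_gt, h.ne', h']
    rw [Finset.sum_congr rfl e3, ← Finset.mul_sum, Finset.sum_add_distrib]
    refine mul_le_mul_of_nonneg_left ?_ hH
    push_cast at e2 ⊢
    linarith
  rw [Finset.sum_add_distrib] at s3
  have s5 := sum_two_pow_card_le P hz hP (2 * r)
  linarith

/-! ### Local densities for the pair `n`, `n + d`. -/

theorem card_filter_modEq_sub_le (N m v : ℕ) (hm : 0 < m) :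
    |(((Finset.Ioc 0 N).filter fun n => n ≡ v [MOD m]).card : ℝ) - N / m| ≤ 1 := by
  have h := Nat.Ioc_filter_modEq_card 0 N hm v
  have hm' : (0 : ℚ) < m := by exact_mod_cast hm
  have h1 : (((Finset.Ioc 0 N).filter fun n => n ≡ v [MOD m]).card : ℚ) =
      ((max (⌊((N : ℚ) - v) / m⌋ - ⌊((0 : ℕ) - v : ℚ) / m⌋) 0 : ℤ) : ℚ) := by
    exact_mod_cast congrArg (Int.cast : ℤ → ℚ) h
  have h2 : ⌊((0 : ℕ) - v : ℚ) / m⌋ ≤ ⌊((N : ℚ) - v) / m⌋ := by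
    apply Int.floor_le_floor
    gcongr
    simp
  rw [max_eq_left (by linarith)] at h1
  have h3 : |(((Finset.Ioc 0 N).filter fun n => n ≡ v [MOD m]).card : ℚ) - N / m| ≤ 1 := by
    rw [h1, abs_le]
    push_cast
    have a1 := Int.floor_le (((N : ℚ) - v) / m)
    have a2 := Int.lt_floor_add_one (((N : ℚ) - v) / m)
    have a3 := Int.floor_le ((((0 : ℕ) : ℚ) - v) / m)
    have a4 := Int.lt_floor_add_one ((((0 : ℕ) : ℚ) - v) / m)
    simp only [sub_div, Nat.cast_zero, zero_div] at *
    constructor <;> linarith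
  have h4 := (Rat.cast_le (K := ℝ)).2 h3
  push_cast at h4
  exact h4

theorem card_filter_forall_modEq_sub_le (N : ℕ) (S : Finset ℕ) (hS : ∀ q ∈ S, q.Prime)
    (a : ℕ → ℕ) :
    |(((Finset.Ioc 0 N).filter fun n => ∀ q ∈ S, n ≡ a q [MOD q]).card : ℝ) -
      N * ∏ q ∈ S, ((q : ℝ)⁻¹)| ≤ 1 := by
  have hco : Set.Pairwise (S : Set ℕ) (Function.onFun Nat.Coprime fun q => q) :=
    fun p hp q hq hpq => (Nat.coprime_primes (hS p hp) (hS q hq)).2 hpq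
  let x := Nat.chineseRemainderOfFinset a (fun q => q) S (fun q hq => (hS q hq).ne_zero) hco
  have hx : ∀ n, (∀ q ∈ S, n ≡ a q [MOD q]) ↔ n ≡ x [MOD ∏ q ∈ S, q] := by
    intro n
    constructor
    · intro h
      have : ∀ q ∈ S, n ≡ x [MOD q] := fun q hq => (h q hq).trans (x.2 q hq).symm
      rw [Nat.modEq_iff_dvd]
      push_cast
      refine Finset.prod_dvd_of_coprime (fun p hp q hq hpq => ?_)
        fun q hq => (Nat.modEq_iff_dvd.1 (this q hq))
      exact Nat.isCoprime_iff_coprime.2 (hco hp hq hpq)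
    · intro h q hq
      exact (h.of_dvd (Finset.dvd_prod_of_mem (fun q => q) hq)).trans (x.2 q hq)
  simp only [hx]
  have := card_filter_modEq_sub_le N (∏ q ∈ S, q) x (Finset.prod_pos fun q hq => (hS q hq).pos)
  rwa [Finset.prod_inv_distrib, ← div_eq_mul_inv, ← Nat.cast_prod]

/-- A prime `q > d` cannot divide both `n` and `n + d`, so each `q` removes two distinct classes.
Choosing one class per prime splits the count into `2 ^ |S|` Chinese remainder problems, each with
error at most `1`. -/
theorem card_filter_forall_dvd_or_sub_le (N d : ℕ) (hd : 0 < d) (S : Finset ℕ)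
    (hS : ∀ q ∈ S, q.Prime) (hSd : ∀ q ∈ S, d < q) :
    |(((Finset.Ioc 0 N).filter fun n => ∀ q ∈ S, q ∣ n ∨ q ∣ n + d).card : ℝ) -
      N * ∏ q ∈ S, (2 / (q : ℝ))| ≤ 2 ^ S.card := by
  -- `T` is the set of primes dividing `n`; the other primes of `S` divide `n + d`, that is, `n ≡ q
  -- - d`.
  let a : Finset ℕ → ℕ → ℕ := fun T q => if q ∈ T then 0 else q - d
  have key : (((Finset.Ioc 0 N).filter fun n => ∀ q ∈ S, q ∣ n ∨ q ∣ n + d).card : ℝ) =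
      ∑ T ∈ S.powerset,
        (((Finset.Ioc 0 N).filter fun n => ∀ q ∈ S, n ≡ a T q [MOD q]).card : ℝ) := by
    simp only [Finset.card_filter]
    push_cast
    rw [Finset.sum_comm]
    refine Finset.sum_congr rfl fun n _ => ?_
    have h1 : (if ∀ q ∈ S, q ∣ n ∨ q ∣ n + d then (1 : ℝ) else 0) =
        ∏ q ∈ S, ((if q ∣ n then 1 else 0) + if q ∣ n + d then 1 else 0) := by
      have : ∀ q ∈ S, ((if q ∣ n then (1 : ℝ) else 0) + if q ∣ n + d then 1 else 0) =
          if q ∣ n ∨ q ∣ n + d then 1 else 0 := by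
        intro q hq
        by_cases e1 : q ∣ n
        · have : ¬ q ∣ n + d := fun h =>
            (Nat.le_of_dvd hd ((Nat.dvd_add_right e1).1 h)).not_gt (hSd q hq)
          simp [e1, this]
        · simp [e1]
      rw [Finset.prod_congr rfl this, Finset.prod_ite_zero, Finset.prod_const_one]
    rw [h1, Finset.prod_add]
    refine Finset.sum_congr rfl fun T hT => ?_
    rw [Finset.mem_powerset] at hT
    rw [Finset.prod_ite_zero, Finset.prod_ite_zero, Finset.prod_const_one, Finset.prod_const_one,
      ite_zero_mul_ite_zero, one_mul]
    refine if_congr ⟨fun h q hq => ?_, fun h => ⟨fun q hq => ?_, fun q hq => ?_⟩⟩ rfl rfl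
    · by_cases hqT : q ∈ T
      · simpa [a, hqT] using (Nat.modEq_zero_iff_dvd.2 (h.1 q hqT))
      · have h2 := h.2 q (Finset.mem_sdiff.2 ⟨hq, hqT⟩)
        simp only [a, hqT, if_false]
        refine Nat.ModEq.add_right_cancel' d ?_
        rw [Nat.sub_add_cancel (hSd q hq).le]
        exact (Nat.modEq_zero_iff_dvd.2 h2).trans (Nat.modEq_zero_iff_dvd.2 dvd_rfl).symm
    · have := h q (hT hq)
      simp only [a, hq, if_true] at this
      exact Nat.modEq_zero_iff_dvd.1 this
    · have hq' := Finset.mem_sdiff.1 hq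
      have := (h q hq'.1).add_right d
      simp only [a, hq'.2, if_false] at this
      rw [Nat.sub_add_cancel (hSd q hq'.1).le] at this
      exact Nat.modEq_zero_iff_dvd.1 (this.trans (Nat.modEq_zero_iff_dvd.2 dvd_rfl))
  have e : (N : ℝ) * ∏ q ∈ S, (2 / (q : ℝ)) =
      ∑ T ∈ S.powerset, (N : ℝ) * ∏ q ∈ S, ((q : ℝ)⁻¹) := by
    simp only [div_eq_mul_inv, Finset.prod_mul_distrib, Finset.prod_const, Finset.sum_const,
      Finset.card_powerset, nsmul_eq_mul]
    push_cast
    ring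
  rw [key, e, ← Finset.sum_sub_distrib]
  refine (Finset.abs_sum_le_sum_abs _ _).trans ?_
  refine (Finset.sum_le_sum fun T _ => card_filter_forall_modEq_sub_le N S hS (a T)).trans ?_
  simp

/-- Upper bound for the number of `n ≤ N` for which `n` and `n + d` are both free of prime
factors from `P`, where `P` consists of primes larger than `d`. -/
theorem card_sifted_pairs_le (N d : ℕ) (hd : 0 < d) (P : Finset ℕ) (hP : ∀ q ∈ P, q.Prime)
    (hPd : ∀ q ∈ P, d < q) (hP2 : ∀ q ∈ P, 2 < q) (z : ℝ) (hz : 1 ≤ z) (hPz : (P.card : ℝ) ≤ z)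
    (r : ℕ) :
    (((Finset.Ioc 0 N).filter fun n => ∀ q ∈ P, ¬ (q ∣ n ∨ q ∣ n + d)).card : ℝ) ≤
      N * (∏ q ∈ P, (1 - 2 / (q : ℝ)) +
        Real.exp (Real.exp 1 * ∑ q ∈ P, 2 / (q : ℝ) - (2 * r : ℕ))) + z ^ (2 * r) * Real.exp 2 := by
  refine brun_sieve_upper _ P (fun q n => q ∣ n ∨ q ∣ n + d) (fun q => 2 / (q : ℝ)) N z
    (Nat.cast_nonneg _) hz hPz (fun q _ => by positivity) (fun q hq => ?_) (fun S hS => ?_) r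
  · have := hP2 q hq
    rw [div_le_one (by positivity)]
    exact_mod_cast this.le
  · exact card_filter_forall_dvd_or_sub_le N d hd S (fun q hq => hP q (hS hq))
      fun q hq => hPd q (hS hq)

/-! ### Weak Mertens estimates. -/

/-- On this block `log q ≥ (2 ^ m * m * log 2) / q`, while Chebyshev bounds the sum of `log q` by `2
^ (m + 1) * log 4`. -/
theorem sum_inv_primes_dyadic_le (m : ℕ) (hm : 0 < m) :
    ∑ q ∈ (Nat.primesLE (2 ^ (m + 1))).filter (2 ^ m < ·), ((q : ℝ)⁻¹) ≤ 4 * (m : ℝ)⁻¹ := by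
  have hm' : (0 : ℝ) < m := by exact_mod_cast hm
  have hl : 0 < Real.log 2 := Real.log_pos one_lt_two
  have h1 : ∑ q ∈ (Nat.primesLE (2 ^ (m + 1))).filter (2 ^ m < ·), Real.log q ≤
      Real.log 4 * 2 ^ (m + 1) := by
    have h := Chebyshev.theta_le_log4_mul_x (x := ((2 ^ (m + 1) : ℕ) : ℝ)) (Nat.cast_nonneg _)
    rw [Chebyshev.theta_eq_sum_primesLE_log] at h
    push_cast at h
    refine le_trans (Finset.sum_le_sum_of_subset_of_nonneg (Finset.filter_subset _ _) ?_) h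
    intro q hq _
    exact Real.log_natCast_nonneg q
  have h2 : (2 ^ m * (m * Real.log 2)) *
      ∑ q ∈ (Nat.primesLE (2 ^ (m + 1))).filter (2 ^ m < ·), ((q : ℝ)⁻¹) ≤
      ∑ q ∈ (Nat.primesLE (2 ^ (m + 1))).filter (2 ^ m < ·), Real.log q := by
    rw [Finset.mul_sum]
    refine Finset.sum_le_sum fun q hq => ?_
    have hq2 : (2 : ℝ) ^ m < q := by exact_mod_cast (Finset.mem_filter.1 hq).2
    have hq0 : (0 : ℝ) < q := lt_trans (by positivity) hq2
    rw [← div_eq_mul_inv, div_le_iff₀ hq0, mul_comm]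
    have h3 : m * Real.log 2 ≤ Real.log q := by
      rw [← Real.log_pow]
      exact Real.log_le_log (by positivity) hq2.le
    gcongr
  have h4 : Real.log 4 = 2 * Real.log 2 := by
    rw [show (4 : ℝ) = 2 ^ 2 by norm_num, Real.log_pow]; norm_num
  rw [h4] at h1
  have h5 := h2.trans h1
  rw [← div_eq_mul_inv, le_div_iff₀ hm']
  have h6 : (2 ^ m * Real.log 2) *
      ((∑ q ∈ (Nat.primesLE (2 ^ (m + 1))).filter (2 ^ m < ·), ((q : ℝ)⁻¹)) * m) ≤
      (2 ^ m * Real.log 2) * 4 := by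
    rw [pow_succ (2 : ℝ)] at h5
    linarith
  exact le_of_mul_le_mul_left h6 (by positivity)

theorem sum_inv_primesLE_two_pow_le (m : ℕ) (hm : 0 < m) :
    ∑ q ∈ Nat.primesLE (2 ^ m), ((q : ℝ)⁻¹) ≤ 5 + 4 * Real.log m := by
  have h : ∀ k : ℕ, ∑ q ∈ Nat.primesLE (2 ^ (k + 1)), ((q : ℝ)⁻¹) ≤ 1 + 4 * (harmonic k : ℝ) := by
    intro k
    induction k with
    | zero =>
      have : Nat.primesLE (2 ^ (0 + 1)) = {2} := by decide
      rw [this]; norm_num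
    | succ k ih =>
      rw [← Finset.sum_filter_add_sum_filter_not _ (2 ^ (k + 1) < ·), harmonic_succ]
      have e : (Nat.primesLE (2 ^ (k + 1 + 1))).filter (¬ 2 ^ (k + 1) < ·) =
          Nat.primesLE (2 ^ (k + 1)) := by
        ext q
        simp only [Finset.mem_filter, Nat.mem_primesLE, not_lt]
        constructor
        · rintro ⟨⟨_, h2⟩, h3⟩
          exact ⟨h3, h2⟩
        · rintro ⟨h1, h2⟩
          exact ⟨⟨h1.trans (Nat.pow_le_pow_right (by norm_num) (by omega)), h2⟩, h1⟩
      rw [e]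
      have := sum_inv_primes_dyadic_le (k + 1) (Nat.succ_pos k)
      push_cast at this ⊢
      linarith
  obtain ⟨k, rfl⟩ := Nat.exists_eq_succ_of_ne_zero hm.ne'
  have h1 := h k
  have h2 : harmonic k ≤ harmonic (k + 1) := by
    rw [harmonic_succ]
    have : (0 : ℚ) ≤ ((k + 1 : ℕ) : ℚ)⁻¹ := by positivity
    linarith
  have h3 : (harmonic k : ℝ) ≤ harmonic (k + 1) := by exact_mod_cast h2
  have h4 := harmonic_le_one_add_log (k + 1)
  simp only [Nat.succ_eq_add_one] at *
  linarith

/-- A weak form of Mertens' third theorem. -/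
theorem log_mul_prod_primesLE_le_one (n : ℕ) :
    Real.log (n + 1) * ∏ q ∈ Nat.primesLE n, (1 - (q : ℝ)⁻¹) ≤ 1 := by
  let f : ℕ →* ℝ :=
    { toFun := fun n => (n : ℝ)⁻¹
      map_one' := by simp
      map_mul' := fun a b => by push_cast; exact mul_inv _ _ }
  have hf : ∀ {p : ℕ}, p.Prime → ‖f p‖ < 1 := by
    intro p hp
    have : (1 : ℝ) < p := by exact_mod_cast hp.one_lt
    simpa [f] using inv_lt_one_of_one_lt₀ this
  have h := (EulerProduct.summable_and_hasSum_smoothNumbers_prod_primesBelow_geometric hf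
    (n + 1)).2
  -- The Euler product sums `1 / i` over all integers `i` composed of primes at most `n`, among them
  -- `1, ..., n`.
  have h1 : (harmonic n : ℝ) ≤ ∏ p ∈ (n + 1).primesBelow, (1 - f p)⁻¹ := by
    have hs : ∀ i ∈ Finset.Icc 1 n, i ∈ (n + 1).smoothNumbers := fun i hi =>
      Nat.mem_smoothNumbers_of_lt (Finset.mem_Icc.1 hi).1 (Nat.lt_succ_of_le (Finset.mem_Icc.1 hi).2)
    have h2 := sum_le_hasSum ((Finset.Icc 1 n).subtype (· ∈ (n + 1).smoothNumbers))
      (fun i _ => by simp [f]) h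
    rw [Finset.sum_subtype_of_mem (fun i => f i) hs] at h2
    rw [harmonic_eq_sum_Icc]
    push_cast
    exact h2
  have h3 : 0 < ∏ q ∈ Nat.primesLE n, (1 - (q : ℝ)⁻¹) := by
    refine Finset.prod_pos fun q hq => ?_
    have : (1 : ℝ) < q := by exact_mod_cast (Nat.mem_primesLE.1 hq).2.one_lt
    exact sub_pos.2 (inv_lt_one_of_one_lt₀ this)
  rw [Finset.prod_inv_distrib] at h1
  have h4 := log_add_one_le_harmonic n
  have h5 : Real.log (n + 1) ≤ (∏ q ∈ Nat.primesLE n, (1 - (q : ℝ)⁻¹))⁻¹ := by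
    push_cast at h4
    exact h4.trans h1
  calc _ ≤ (∏ q ∈ Nat.primesLE n, (1 - (q : ℝ)⁻¹))⁻¹ * ∏ q ∈ Nat.primesLE n, (1 - (q : ℝ)⁻¹) := by
        gcongr
    _ = 1 := inv_mul_cancel₀ h3.ne'

theorem exp_neg_two_mul_le {x : ℝ} (h0 : 0 ≤ x) (h1 : x ≤ 1 / 2) :
    Real.exp (-(2 * x)) ≤ 1 - x := by
  rw [Real.exp_neg, inv_le_comm₀ (Real.exp_pos _) (by linarith)]
  have h2 := Real.add_one_le_exp (2 * x)
  refine le_trans ?_ h2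
  rw [inv_le_iff_one_le_mul₀ (by linarith)]
  nlinarith

/-- Combines `1 - x ≥ exp (-2x)` with the bound `5 + 4 log j` for the sum of reciprocals; doubling
gives the constants `10` and `8`. -/
theorem le_prod_primesLE_two_pow (j : ℕ) (hj : 0 < j) :
    Real.exp (-10) / (j : ℝ) ^ 8 ≤ ∏ q ∈ Nat.primesLE (2 ^ j), (1 - (q : ℝ)⁻¹) := by
  have hj' : (0 : ℝ) < j := by exact_mod_cast hj
  have h1 := sum_inv_primesLE_two_pow_le j hj
  calc Real.exp (-10) / (j : ℝ) ^ 8 = Real.exp (-(2 * (5 + 4 * Real.log j))) := by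
        rw [show -(2 * (5 + 4 * Real.log j)) = -10 - (8 : ℕ) * Real.log j by push_cast; ring,
          Real.exp_sub, Real.exp_nat_mul, Real.exp_log hj']
    _ ≤ Real.exp (∑ q ∈ Nat.primesLE (2 ^ j), -(2 * (q : ℝ)⁻¹)) := by
        rw [Finset.sum_neg_distrib, ← Finset.mul_sum]
        gcongr
    _ = ∏ q ∈ Nat.primesLE (2 ^ j), Real.exp (-(2 * (q : ℝ)⁻¹)) := Real.exp_sum _ _
    _ ≤ _ := by
        refine Finset.prod_le_prod (fun q _ => (Real.exp_pos _).le) fun q hq => ?_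
        have : (2 : ℝ) ≤ q := by exact_mod_cast (Nat.mem_primesLE.1 hq).2.two_le
        refine exp_neg_two_mul_le (by positivity) ?_
        rw [one_div]
        exact inv_anti₀ two_pos this

/-- The sifting product over primes in `(2 ^ j, 2 ^ m]`. -/
theorem prod_one_sub_two_div_le (j m : ℕ) (hj : 0 < j) (hjm : j ≤ m) :
    ∏ q ∈ (Nat.primesLE (2 ^ m)).filter (2 ^ j < ·), (1 - 2 / (q : ℝ)) ≤
      Real.exp 20 * (j : ℝ) ^ 16 / (m * Real.log 2) ^ 2 := by
  set P := (Nat.primesLE (2 ^ m)).filter (2 ^ j < ·) with hP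
  have hj' : (0 : ℝ) < j := by exact_mod_cast hj
  have hm' : (0 : ℝ) < m := by exact_mod_cast hj.trans_le hjm
  have hl : 0 < Real.log 2 := Real.log_pos one_lt_two
  have e : (Nat.primesLE (2 ^ m)).filter (¬ 2 ^ j < ·) = Nat.primesLE (2 ^ j) := by
    ext q
    simp only [Finset.mem_filter, Nat.mem_primesLE, not_lt]
    constructor
    · rintro ⟨⟨_, h2⟩, h3⟩
      exact ⟨h3, h2⟩
    · rintro ⟨h1, h2⟩
      exact ⟨⟨h1.trans (Nat.pow_le_pow_right (by norm_num) hjm), h2⟩, h1⟩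
  have hq2 : ∀ q ∈ P, (2 : ℝ) ≤ q := fun q hq => by
    exact_mod_cast (Nat.mem_primesLE.1 (Finset.mem_filter.1 hq).1).2.two_le
  have h1 : ∏ q ∈ P, (1 - 2 / (q : ℝ)) ≤ (∏ q ∈ P, (1 - (q : ℝ)⁻¹)) ^ 2 := by
    rw [← Finset.prod_pow]
    refine Finset.prod_le_prod (fun q hq => ?_) fun q hq => ?_
    · have := hq2 q hq
      rw [sub_nonneg, div_le_one (by linarith)]
      exact this
    · have : 0 ≤ ((q : ℝ)⁻¹) ^ 2 := sq_nonneg _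
      rw [div_eq_mul_inv]
      linarith
  have hP0 : 0 ≤ ∏ q ∈ P, (1 - (q : ℝ)⁻¹) := Finset.prod_nonneg fun q hq => by
    have := hq2 q hq
    exact sub_nonneg.2 (inv_le_one_of_one_le₀ (by linarith))
  have h2 := log_mul_prod_primesLE_le_one (2 ^ m)
  -- The product over all primes up to `2 ^ m` is divided by its part up to `2 ^ j`; this costs only
  -- a power of `j`.
  rw [← Finset.prod_filter_mul_prod_filter_not _ (2 ^ j < ·), e, ← hP] at h2
  have h3 := le_prod_primesLE_two_pow j hj
  have h4 : m * Real.log 2 ≤ Real.log ((2 ^ m : ℕ) + 1) := by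
    rw [← Real.log_pow]
    push_cast
    exact Real.log_le_log (by positivity) (by linarith)
  have h5 : (m * Real.log 2) * ((∏ q ∈ P, (1 - (q : ℝ)⁻¹)) * (Real.exp (-10) / (j : ℝ) ^ 8)) ≤ 1 := by
    refine le_trans ?_ h2
    gcongr
    exact le_trans (by positivity) h4
  have h6 : ∏ q ∈ P, (1 - (q : ℝ)⁻¹) ≤ Real.exp 10 * (j : ℝ) ^ 8 / (m * Real.log 2) := by
    rw [le_div_iff₀ (by positivity)]
    have h7 : Real.exp 10 * Real.exp (-10) = 1 := by rw [← Real.exp_add]; simp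
    calc _ = Real.exp 10 * (j : ℝ) ^ 8 * ((m * Real.log 2) *
          ((∏ q ∈ P, (1 - (q : ℝ)⁻¹)) * (Real.exp (-10) / (j : ℝ) ^ 8))) := by
          generalize ∏ q ∈ P, (1 - (q : ℝ)⁻¹) = p
          field_simp
          linear_combination (-p) * h7
      _ ≤ Real.exp 10 * (j : ℝ) ^ 8 * 1 := by gcongr
      _ = _ := mul_one _
  calc _ ≤ _ := h1
    _ ≤ (Real.exp 10 * (j : ℝ) ^ 8 / (m * Real.log 2)) ^ 2 := by gcongr
    _ = _ := by
      rw [div_pow, mul_pow, ← Real.exp_nat_mul, ← pow_mul]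
      norm_num

/-! ### Chebyshev's lower bound. -/

/-- Bound for the central binomial coefficient in terms of the number of primes in `(n, 2n]`. -/
theorem centralBinom_le_mul_pow_card (n : ℕ) (hn : 2 < n) :
    n.centralBinom ≤ (2 * n) ^ Nat.sqrt (2 * n) * 4 ^ (2 * n / 3) *
      (2 * n) ^ ((Finset.Ioc n (2 * n)).filter Nat.Prime).card := by
  let f : ℕ → ℕ := fun p => p ^ n.centralBinom.factorization p
  have n2 : 1 ≤ 2 * n := by omega
  let S := (Finset.range (2 * n + 1)).filter Nat.Prime
  have h0 : n.centralBinom = ∏ p ∈ S, f p := by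
    rw [← n.prod_pow_factorization_centralBinom]
    refine (Finset.prod_filter_of_ne fun p _ h => ?_).symm
    contrapose h
    rw [Nat.factorization_eq_zero_of_not_prime n.centralBinom h, pow_zero]
  have hf : ∀ p, f p ≤ 2 * n := fun p => Nat.pow_factorization_choose_le (by omega)
  -- As in Erdős's proof of Bertrand's postulate: prime powers are at most `2n`, primes above
  -- `√(2n)` have exponent at most one, and those in `(2n/3, n]` do not occur. Here the primes in
  -- `(n, 2n]` are kept and counted.
  rw [h0, ← Finset.prod_filter_not_mul_prod_filter S (n < ·),
    ← Finset.prod_filter_mul_prod_filter_not (S.filter (¬ n < ·)) (· ≤ Nat.sqrt (2 * n))]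
  refine mul_le_mul' (mul_le_mul' ?_ ?_) ?_
  · refine (Finset.prod_le_prod' fun p _ => hf p).trans ?_
    rw [Finset.prod_const]
    refine pow_right_mono₀ n2 ?_
    have : (Finset.Icc 1 (Nat.sqrt (2 * n))).card = Nat.sqrt (2 * n) := by simp
    refine (Finset.card_le_card fun x hx => ?_).trans this.le
    simp only [S, Finset.mem_filter] at hx
    exact Finset.mem_Icc.2 ⟨hx.1.1.2.one_lt.le, hx.2⟩
  · refine le_trans ?_ (primorial_le_four_pow (2 * n / 3))
    have h1 : ∀ p ∈ (S.filter (¬ n < ·)).filter (¬ · ≤ Nat.sqrt (2 * n)),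
        f p ≤ if p ∈ Nat.primesLE (2 * n / 3) then p else 1 := by
      intro p hp
      simp only [S, Finset.mem_filter, not_lt, not_le, Finset.mem_range] at hp
      obtain ⟨⟨⟨_, pp⟩, hpn⟩, hps⟩ := hp
      split_ifs with h
      · refine (pow_right_mono₀ pp.one_lt.le ?_).trans (pow_one p).le
        exact Nat.factorization_choose_le_one (Nat.sqrt_lt'.mp hps)
      · have h2 : 2 * n < 3 * p := by
          by_contra h3
          exact h (Nat.mem_primesLE.2 ⟨by omega, pp⟩)
        dsimp only [f]
        rw [Nat.factorization_centralBinom_of_two_mul_self_lt_three_mul hn hpn h2, pow_zero]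
    refine (Finset.prod_le_prod' h1).trans ?_
    rw [← Finset.prod_filter, primorial_eq_prod_primesLE]
    refine Finset.prod_le_prod_of_subset_of_one_le' (fun p hp => (Finset.mem_filter.1 hp).2) ?_
    intro p hp _
    exact (Nat.mem_primesLE.1 hp).2.one_lt.le
  · refine (Finset.prod_le_prod' fun p _ => hf p).trans ?_
    rw [Finset.prod_const]
    refine pow_right_mono₀ n2 (Finset.card_le_card fun x hx => ?_)
    simp only [S, Finset.mem_filter, Finset.mem_range] at hx
    exact Finset.mem_filter.2 ⟨Finset.mem_Ioc.2 ⟨hx.2, by omega⟩, hx.1.2⟩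

/-- Logarithmic form of the lower bound for the number of primes in `(n, 2n]`. -/
theorem le_card_primes_Ioc_mul_log (n : ℕ) (hn : 4 ≤ n) :
    n / 3 * Real.log 4 - (√(2 * n) + 1) * Real.log (2 * n) ≤
      ((Finset.Ioc n (2 * n)).filter Nat.Prime).card * Real.log (2 * n) := by
  set k := ((Finset.Ioc n (2 * n)).filter Nat.Prime).card
  have h1 := Nat.four_pow_lt_mul_centralBinom n hn
  have h2 := centralBinom_le_mul_pow_card n (by omega)
  have h3 : 4 ^ n ≤ (2 * n) * ((2 * n) ^ Nat.sqrt (2 * n) * 4 ^ (2 * n / 3) * (2 * n) ^ k) :=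
    h1.le.trans (Nat.mul_le_mul (by omega) h2)
  have hn0 : (0 : ℝ) < n := by exact_mod_cast (by omega : 0 < n)
  have h4 : (4 : ℝ) ^ n ≤ (2 * n) * ((2 * n) ^ Nat.sqrt (2 * n) * 4 ^ (2 * n / 3) * (2 * n) ^ k) := by
    exact_mod_cast h3
  have h5 := Real.log_le_log (by positivity) h4
  rw [Real.log_mul (by positivity) (by positivity),
    Real.log_mul (y := (2 * (n : ℝ)) ^ k) (by positivity) (by positivity),
    Real.log_mul (y := 4 ^ (2 * n / 3)) (by positivity) (by positivity), Real.log_pow, Real.log_pow, Real.log_pow,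
    Real.log_pow] at h5
  have h6 : (Nat.sqrt (2 * n) : ℝ) ≤ √(2 * n) := by
    have := Real.nat_sqrt_le_real_sqrt (a := 2 * n)
    push_cast at this
    exact this
  have h7 : ((2 * n / 3 : ℕ) : ℝ) ≤ 2 * n / 3 := by
    have := Nat.cast_div_le (α := ℝ) (m := 2 * n) (n := 3)
    push_cast at this
    exact this
  have hn4 : (4 : ℝ) ≤ n := by exact_mod_cast hn
  have hl : 0 ≤ Real.log (2 * n) := Real.log_nonneg (by linarith)
  have hl4 : 0 ≤ Real.log 4 := Real.log_nonneg (by norm_num)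
  have h8 := mul_le_mul_of_nonneg_right h6 hl
  have h9 := mul_le_mul_of_nonneg_right h7 hl4
  linarith

/-! ### Prime gaps on average. -/

/-- Bertrand's postulate makes the set under the infimum nonempty and supplies the bound `2 * p`. -/
theorem primeGap_spec (p : ℕ) (hp : p.Prime) :
    0 < primeGap p ∧ (p + primeGap p).Prime ∧ p + primeGap p ≤ 2 * p ∧
      ∀ q, q.Prime → p < q → p + primeGap p ≤ q := by
  obtain ⟨q, hq, h1, h2⟩ := Nat.exists_prime_lt_and_le_two_mul p hp.ne_zero
  have hm := Nat.sInf_mem (s := {q : ℕ | q.Prime ∧ p < q}) ⟨q, hq, h1⟩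
  have hle : ∀ q, q.Prime → p < q → sInf {q : ℕ | q.Prime ∧ p < q} ≤ q := fun q h h' =>
    Nat.sInf_le ⟨h, h'⟩
  have h3 : p + primeGap p = sInf {q : ℕ | q.Prime ∧ p < q} := by
    have : p < sInf {q : ℕ | q.Prime ∧ p < q} := hm.2
    unfold primeGap
    omega
  have h4 := hm.2
  rw [h3]
  exact ⟨by omega, hm.1, (hle q hq h1).trans h2, hle⟩

/-- The intervals from a prime to its successor are disjoint and, by Bertrand, lie in `(0, 2M]`. -/
theorem sum_primeGap_le (M : ℕ) (B : Finset ℕ) (hB : ∀ p ∈ B, p.Prime ∧ p ≤ M) :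
    ∑ p ∈ B, primeGap p ≤ 2 * M := by
  have hd : Set.PairwiseDisjoint (B : Set ℕ) fun p => Finset.Ioc p (p + primeGap p) := by
    intro p hp q hq hpq
    rw [Function.onFun, Finset.disjoint_left]
    intro x hx hx'
    rw [Finset.mem_Ioc] at hx hx'
    have hpp := (hB p hp).1
    have hqq := (hB q hq).1
    rcases lt_or_gt_of_ne hpq with h | h
    · have := (primeGap_spec p hpp).2.2.2 q hqq h
      omega
    · have := (primeGap_spec q hqq).2.2.2 p hpp h
      omega
  have h1 := Finset.card_biUnion hd
  simp only [Nat.card_Ioc, Nat.add_sub_cancel_left] at h1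
  rw [← h1]
  have : (Finset.Ioc 0 (2 * M)).card = 2 * M := by simp
  refine (Finset.card_le_card fun x hx => ?_).trans this.le
  rw [Finset.mem_biUnion] at hx
  obtain ⟨p, hp, hx⟩ := hx
  rw [Finset.mem_Ioc] at hx ⊢
  have h2 := (primeGap_spec p (hB p hp).1).2.2.1
  have h3 := (hB p hp).2
  omega

/-! ### Counting strings of low complexity. -/

theorem exists_finset_length_lt (k : ℕ) :
    ∃ S : Finset (List Bool), (∀ l : List Bool, l.length < k → l ∈ S) ∧ S.card + 1 ≤ 2 ^ k := by
  induction k with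
  | zero => exact ⟨∅, by simp, by simp⟩
  | succ k ih =>
    obtain ⟨S, hS, hc⟩ := ih
    refine ⟨insert [] (S.image (List.cons true) ∪ S.image (List.cons false)), ?_, ?_⟩
    · intro l hl
      match l with
      | [] => simp
      | true :: l => simp [hS l (by simpa using hl)]
      | false :: l => simp [hS l (by simpa using hl)]
    · have h1 := Finset.card_insert_le ([] : List Bool)
        (S.image (List.cons true) ∪ S.image (List.cons false))
      have h2 := Finset.card_union_le (S.image (List.cons true)) (S.image (List.cons false))
      have h3 := Finset.card_image_le (s := S) (f := List.cons true)
      have h4 := Finset.card_image_le (s := S) (f := List.cons false)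
      rw [pow_succ]
      omega

/-- Fewer than `2 ^ k` objects have complexity less than `k`. -/
theorem card_le_of_condKolmogorov_lt {U : List Bool → List Bool →. List Bool}
    (hU : IsUniversalPrefixFreeMachine U) {code : ℕ → List Bool}
    (hcode : Function.Injective code) (y : List Bool) (k : ℕ) (G : Finset ℕ)
    (hG : ∀ d ∈ G, condKolmogorov U (code d) y < k) : G.card ≤ 2 ^ k := by
  obtain ⟨S, hS, hc⟩ := exists_finset_length_lt k
  choose f hf using fun d => hU.exists_program (code d) y
  refine le_trans (Finset.card_le_card_of_injOn f (fun d hd => ?_) fun a _ b _ hab => ?_)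
    (Nat.le_of_succ_le hc)
  · exact hS _ ((hf d).1 ▸ hG d hd)
  · have h1 := (hf a).2
    rw [hab] at h1
    exact hcode (Part.mem_unique h1 (hf b).2)

/-! ### Sieve bound for prime pairs. -/

theorem card_prime_pairs_le (X : ℝ) (N d j m r : ℕ) (hd : 0 < d) (hdj : d ≤ 2 ^ j) (hj : 0 < j)
    (hjm : j ≤ m) (hmX : (2 : ℝ) ^ m < X) :
    (((Finset.Ioc 0 N).filter fun p : ℕ => p.Prime ∧ X ≤ p ∧ (p + d).Prime).card : ℝ) ≤
      N * (Real.exp 20 * (j : ℝ) ^ 16 / (m * Real.log 2) ^ 2 +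
        Real.exp (Real.exp 1 * (10 + 8 * Real.log m) - (2 * r : ℕ))) +
        (2 ^ m) ^ (2 * r) * Real.exp 2 := by
  set P := (Nat.primesLE (2 ^ m)).filter (2 ^ j < ·)
  have hPm : ∀ q ∈ P, q.Prime ∧ q ≤ 2 ^ m ∧ 2 ^ j < q := fun q hq => by
    have h1 := Finset.mem_filter.1 hq
    have h2 := Nat.mem_primesLE.1 h1.1
    exact ⟨h2.2, h2.1, h1.2⟩
  have h2j : 2 ≤ 2 ^ j := Nat.le_self_pow hj.ne' 2
  have hPc : (P.card : ℝ) ≤ 2 ^ m := by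
    have : P ⊆ Finset.Ioc 0 (2 ^ m) := fun q hq =>
      Finset.mem_Ioc.2 ⟨(hPm q hq).1.pos, (hPm q hq).2.1⟩
    have h := Finset.card_le_card this
    rw [Nat.card_Ioc, Nat.sub_zero] at h
    exact_mod_cast h
  have h := card_sifted_pairs_le N d hd P (fun q hq => (hPm q hq).1)
    (fun q hq => hdj.trans_lt (hPm q hq).2.2) (fun q hq => h2j.trans_lt (hPm q hq).2.2)
    (2 ^ m) (one_le_pow₀ one_le_two) hPc r
  have hsum : ∑ q ∈ P, 2 / (q : ℝ) ≤ 10 + 8 * Real.log m := by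
    have h1 := sum_inv_primesLE_two_pow_le m (hj.trans_le hjm)
    have h2 : ∑ q ∈ P, ((q : ℝ)⁻¹) ≤ ∑ q ∈ Nat.primesLE (2 ^ m), ((q : ℝ)⁻¹) :=
      Finset.sum_le_sum_of_subset_of_nonneg (Finset.filter_subset _ _) fun _ _ _ => by positivity
    simp only [div_eq_mul_inv, ← Finset.mul_sum]
    linarith
  have hprod := prod_one_sub_two_div_le j m hj hjm
  -- Both primes exceed `2 ^ m`, so no sieving prime divides either.
  have hsub : ((Finset.Ioc 0 N).filter fun p : ℕ => p.Prime ∧ X ≤ p ∧ (p + d).Prime) ⊆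
      (Finset.Ioc 0 N).filter fun n => ∀ q ∈ P, ¬ (q ∣ n ∨ q ∣ n + d) := by
    intro p hp
    rw [Finset.mem_filter] at hp ⊢
    refine ⟨hp.1, fun q hq hqp => ?_⟩
    have hlt : q < p := by
      have h1 : (q : ℝ) ≤ 2 ^ m := by exact_mod_cast (hPm q hq).2.1
      exact_mod_cast h1.trans_lt (hmX.trans_le hp.2.2.1)
    rcases hqp with hqp | hqp
    · exact hlt.ne ((Nat.prime_dvd_prime_iff_eq (hPm q hq).1 hp.2.1).1 hqp)
    · exact (Nat.lt_add_right d hlt).ne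
        ((Nat.prime_dvd_prime_iff_eq (hPm q hq).1 hp.2.2.2).1 hqp)
  have hc : (((Finset.Ioc 0 N).filter fun p : ℕ => p.Prime ∧ X ≤ p ∧ (p + d).Prime).card : ℝ) ≤
      ((Finset.Ioc 0 N).filter fun n => ∀ q ∈ P, ¬ (q ∣ n ∨ q ∣ n + d)).card := by
    exact_mod_cast Finset.card_le_card hsub
  refine hc.trans (h.trans ?_)
  gcongr

theorem eventually_loglog {p : ℝ → Prop} (h : ∀ᶠ y in Filter.atTop, p y) :
    ∀ᶠ X in Filter.atTop, p (Real.log (Real.log X)) :=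
  Real.tendsto_log_atTop.eventually (Real.tendsto_log_atTop.eventually h)

theorem eventually_mul_loglog_sq_le_log :
    ∀ᶠ X in Filter.atTop, 400 * Real.log (Real.log X) ^ 2 ≤ Real.log X := by
  have h := (Real.isLittleO_pow_log_id_atTop (n := 2)).bound (show (0 : ℝ) < 1 / 400 by norm_num)
  filter_upwards [Real.tendsto_log_atTop.eventually h,
    Real.tendsto_log_atTop.eventually_ge_atTop 0] with X hX h0
  simp only [id, Real.norm_eq_abs, abs_of_nonneg h0, abs_pow, sq_abs] at hX
  linarith

/-- Brun's bound, up to powers of `log log X`, for pairs of primes at a small distance. -/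
theorem eventually_card_prime_pairs_le :
    ∃ C : ℝ, 0 < C ∧ ∀ᶠ X : ℝ in Filter.atTop, ∀ d : ℕ, 0 < d →
      d ≤ 2 ^ ⌈3 * Real.log (Real.log X)⌉₊ →
      (((Finset.Ioc 0 ⌊2 * X⌋₊).filter fun p : ℕ => p.Prime ∧ X ≤ p ∧ (p + d).Prime).card : ℝ) ≤
        C * X * Real.log (Real.log X) ^ 18 / Real.log X ^ 2 := by
  have hl2 : 0 < Real.log 2 := Real.log_pos one_lt_two
  refine ⟨2 * (Real.exp 20 * 4 ^ 16 * 100 ^ 2 / Real.log 2 ^ 2 + 1) + Real.exp 2, by positivity, ?_⟩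
  filter_upwards [eventually_loglog (Filter.eventually_ge_atTop 5),
    eventually_mul_loglog_sq_le_log, Filter.eventually_gt_atTop 0] with X hl hY hX d hd hdj
  set Y := Real.log X with hYdef
  set l := Real.log Y with hldef
  have hY0 : 0 < Y := by nlinarith
  have eX : Real.exp Y = X := Real.exp_log hX
  have eY : Real.exp l = Y := Real.exp_log hY0
  have hl0 : 0 < l := by linarith
  have hj1 := Nat.le_ceil (3 * l)
  have hj2 := Nat.ceil_lt_add_one (show 0 ≤ 3 * l by positivity)
  have hr1 := Nat.le_ceil (15 * l)
  have hr2 := Nat.ceil_lt_add_one (show 0 ≤ 15 * l by positivity)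
  have hm1 := Nat.floor_le (show 0 ≤ Y / (50 * l) by positivity)
  have hm2 := Nat.lt_floor_add_one (Y / (50 * l))
  -- `2 ^ j` bounds `d`. The truncation level `r` makes Rankin's error at most `exp (-2l) = Y⁻²`,
  -- which needs `l ≥ 5`. Then `m` is small enough that `2 ^ (2 * m * r) ≤ exp (Y / 2)`. The
  -- exponent `18` is `16` from `j ^ 16` plus `2` from `m⁻²`.
  set j := ⌈3 * l⌉₊
  set r := ⌈15 * l⌉₊
  set m := ⌊Y / (50 * l)⌋₊
  have h8 : 8 * l ≤ Y / (50 * l) := by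
    rw [le_div_iff₀ (by positivity)]; nlinarith
  have h100 : Y / (50 * l) = 2 * (Y / (100 * l)) := by field_simp; norm_num
  have hm3 : Y / (100 * l) ≤ m := by linarith
  have hjm : (j : ℝ) ≤ m := by linarith
  have hjm' : j ≤ m := by exact_mod_cast hjm
  have hj0 : 0 < j := by
    have : (0 : ℝ) < j := by linarith
    exact_mod_cast this
  have hm0 : (0 : ℝ) < m := by
    have : (0 : ℝ) < j := by exact_mod_cast hj0
    linarith
  have hl2' : Real.log 2 < 0.7 := by linarith [Real.log_two_lt_d9]
  have hpow : ∀ k : ℕ, (2 : ℝ) ^ k = Real.exp (k * Real.log 2) := fun k => by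
    rw [Real.exp_nat_mul, Real.exp_log two_pos]
  have hmY : m * (50 * l) ≤ Y := by
    rwa [le_div_iff₀ (by positivity)] at hm1
  have hmX : (2 : ℝ) ^ m < X := by
    rw [hpow, ← eX, Real.exp_lt_exp]
    nlinarith
  have h := card_prime_pairs_le X ⌊2 * X⌋₊ d j m r hd hdj hj0 hjm' hmX
  refine h.trans ?_
  have hN := Nat.floor_le (show 0 ≤ 2 * X by positivity)
  have hl18 : 1 ≤ l ^ 18 := one_le_pow₀ (by linarith)
  have b1 : Real.exp 20 * (j : ℝ) ^ 16 / (m * Real.log 2) ^ 2 ≤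
      Real.exp 20 * 4 ^ 16 * 100 ^ 2 / Real.log 2 ^ 2 * (l ^ 18 / Y ^ 2) := by
    calc _ ≤ Real.exp 20 * (4 * l) ^ 16 / (Y / (100 * l) * Real.log 2) ^ 2 := by
          gcongr; linarith
      _ = _ := by field_simp
  have b2 : Real.exp (Real.exp 1 * (10 + 8 * Real.log m) - (2 * r : ℕ)) ≤ 1 * (l ^ 18 / Y ^ 2) := by
    have hml : Real.log m ≤ l := Real.log_le_log hm0 (by nlinarith)
    have he : Real.exp 1 ≤ 2.72 := by linarith [Real.exp_one_lt_d9]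
    have hml0 : 0 ≤ Real.log m := Real.log_natCast_nonneg m
    have h1 : Real.exp 1 * (10 + 8 * Real.log m) ≤ 2.72 * (10 + 8 * l) := by gcongr
    calc _ ≤ Real.exp (-(2 : ℕ) * l) := by
          rw [Real.exp_le_exp]; push_cast; linarith
      _ = 1 * (1 / Y ^ 2) := by
          rw [neg_mul, Real.exp_neg, Real.exp_nat_mul, eY]; simp
      _ ≤ _ := by gcongr
  have b3 : ((2 : ℝ) ^ m) ^ (2 * r) ≤ X * (l ^ 18 / Y ^ 2) := by
    rw [← pow_mul, hpow]
    have h1 : ((m * (2 * r) : ℕ) : ℝ) * Real.log 2 ≤ Y / 2 := by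
      push_cast
      have : (r : ℝ) ≤ 16 * l := by linarith
      calc (m : ℝ) * (2 * r) * Real.log 2 ≤ m * (2 * (16 * l)) * 0.7 := by gcongr
        _ ≤ Y / 2 := by nlinarith
    calc _ ≤ Real.exp (Y - (2 : ℕ) * l) := by
          have : 4 * l ≤ Y := by nlinarith
          rw [Real.exp_le_exp]
          push_cast at h1 ⊢
          linarith
      _ = X * (1 / Y ^ 2) := by
          rw [Real.exp_sub, Real.exp_nat_mul, eY, eX]; ring
      _ ≤ _ := by gcongr
  calc _ ≤ (2 * X) * (Real.exp 20 * 4 ^ 16 * 100 ^ 2 / Real.log 2 ^ 2 * (l ^ 18 / Y ^ 2) +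
        1 * (l ^ 18 / Y ^ 2)) + X * (l ^ 18 / Y ^ 2) * Real.exp 2 := by gcongr
    _ = _ := by ring

/-! ### Primes in `[X, 2X]`: total count and exceptional gaps. -/

theorem dyadicPrimes_finite (X : ℝ) : (dyadicPrimes X).Finite :=
  (Set.finite_Iic ⌊2 * X⌋₊).subset fun _ hp => Nat.le_floor hp.2.2

theorem eventually_le_ncard_dyadicPrimes :
    ∀ᶠ X : ℝ in Filter.atTop, X / (16 * Real.log X) ≤ (dyadicPrimes X).ncard := by
  have ho : (fun x : ℝ => Real.log (2 * x)) =o[Filter.atTop] fun x => x ^ (1 / 2 : ℝ) := by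
    have h1 := (isLittleO_log_rpow_atTop (show (0 : ℝ) < 1 / 2 by norm_num)).comp_tendsto
      (Filter.tendsto_id.const_mul_atTop (two_pos (α := ℝ)))
    refine h1.trans_isBigO (Asymptotics.IsBigO.of_bound 2 ?_)
    filter_upwards [Filter.eventually_ge_atTop 0] with x hx
    simp only [Function.comp, id]
    rw [Real.mul_rpow two_pos.le hx, norm_mul]
    gcongr
    rw [Real.norm_eq_abs, abs_of_pos (by positivity)]
    calc (2 : ℝ) ^ (1 / 2 : ℝ) ≤ 2 ^ (1 : ℝ) := by
          apply Real.rpow_le_rpow_of_exponent_le <;> norm_num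
      _ = 2 := by simp
  have hb := ho.bound (show (0 : ℝ) < 1 / 20 by norm_num)
  have hfl : Filter.Tendsto (fun X : ℝ => (⌊X⌋₊ : ℝ)) Filter.atTop Filter.atTop :=
    tendsto_natCast_atTop_atTop.comp tendsto_nat_floor_atTop
  filter_upwards [hfl.eventually hb, hfl.eventually_ge_atTop 100, Filter.eventually_ge_atTop 100]
    with X h1 h2 hX
  set n := ⌊X⌋₊ with hn
  have hnX : (n : ℝ) ≤ X := Nat.floor_le (by linarith)
  have hnX' := Nat.lt_floor_add_one X
  have hn4 : 4 ≤ n := by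
    have : (4 : ℝ) ≤ n := by linarith
    exact_mod_cast this
  have h3 := le_card_primes_Ioc_mul_log n hn4
  have hL : 0 < Real.log (2 * n) := Real.log_pos (by linarith)
  have hsub : (((Finset.Ioc n (2 * n)).filter Nat.Prime : Finset ℕ) : Set ℕ) ⊆ dyadicPrimes X := by
    intro p hp
    simp only [Finset.coe_filter, Finset.mem_Ioc, Set.mem_ofPred_eq] at hp
    have e1 : ((n + 1 : ℕ) : ℝ) ≤ p := by exact_mod_cast hp.1.1
    have e2 : (p : ℝ) ≤ ((2 * n : ℕ) : ℝ) := by exact_mod_cast hp.1.2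
    push_cast at e1 e2
    exact ⟨hp.2, by linarith, by linarith⟩
  have h4 := Set.ncard_le_ncard hsub (dyadicPrimes_finite X)
  rw [Set.ncard_coe_finset] at h4
  have h4' : (((Finset.Ioc n (2 * n)).filter Nat.Prime).card : ℝ) ≤ (dyadicPrimes X).ncard := by
    exact_mod_cast h4
  rw [Real.norm_eq_abs, Real.norm_eq_abs, abs_of_pos hL, ← Real.sqrt_eq_rpow,
    abs_of_nonneg (Real.sqrt_nonneg _)] at h1
  have hs : √(2 * (n : ℝ)) + 1 ≤ 2 * √n := by
    have e1 : (1 : ℝ) ≤ √n / 10 := by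
      have : √(100 : ℝ) ≤ √n := Real.sqrt_le_sqrt h2
      rw [show (100 : ℝ) = 10 ^ 2 by norm_num, Real.sqrt_sq (by norm_num)] at this
      linarith
    have e2 : √(2 * (n : ℝ)) ≤ 1.5 * √n := by
      rw [Real.sqrt_mul two_pos.le]
      gcongr
      rw [Real.sqrt_le_left (by norm_num)]; norm_num
    linarith
  have h5 : (√(2 * n) + 1) * Real.log (2 * n) ≤ n / 10 := by
    calc _ ≤ (2 * √n) * (1 / 20 * √n) := by gcongr
      _ = √n * √n / 10 := by ring
      _ = _ := by rw [Real.mul_self_sqrt (by positivity)]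
  have hl4 : 1.38 ≤ Real.log 4 := by
    rw [show (4 : ℝ) = 2 ^ 2 by norm_num, Real.log_pow]
    push_cast
    linarith [Real.log_two_gt_d9]
  -- `1.38 / 3 - 1 / 10 > 1 / 4`. The final `16` then comes from `log (2n) ≤ 2 log X` and `n ≥ X /
  -- 2`.
  have h6 : (n : ℝ) / 4 ≤ n / 3 * Real.log 4 - (√(2 * n) + 1) * Real.log (2 * n) := by nlinarith
  have hLX : Real.log (2 * n) ≤ 2 * Real.log X := by
    rw [← Nat.cast_ofNat (n := 2) (R := ℝ), ← Real.log_pow]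
    refine Real.log_le_log (by positivity) ?_
    push_cast
    nlinarith
  have hX0 : 0 < Real.log X := Real.log_pos (by linarith)
  rw [div_le_iff₀ (by positivity)]
  have h7 : (((Finset.Ioc n (2 * n)).filter Nat.Prime).card : ℝ) * Real.log (2 * n) ≤
      (dyadicPrimes X).ncard * (2 * Real.log X) := by gcongr
  linarith

/-- The primes in `[X, 2X]` whose gap lies in a set `G` of small gaps, or is large. -/
theorem eventually_ncard_primeGap_le :
    ∃ C : ℝ, 0 < C ∧ ∀ᶠ X : ℝ in Filter.atTop, ∀ G : Finset ℕ,
      ({p ∈ dyadicPrimes X | primeGap p ≤ 2 ^ ⌈3 * Real.log (Real.log X)⌉₊ → primeGap p ∈ G}.ncard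
        : ℝ) ≤ G.card * (C * X * Real.log (Real.log X) ^ 18 / Real.log X ^ 2) +
          4 * X / Real.log X ^ 2 := by
  obtain ⟨C, hC, h⟩ := eventually_card_prime_pairs_le
  refine ⟨C, hC, ?_⟩
  filter_upwards [h, Filter.eventually_gt_atTop 0, Real.tendsto_log_atTop.eventually_gt_atTop 0,
    eventually_loglog (Filter.eventually_ge_atTop 0)] with X hp hX hY hl G
  set D := 2 ^ ⌈3 * Real.log (Real.log X)⌉₊ with hD
  set N := ⌊2 * X⌋₊
  have hN : (N : ℝ) ≤ 2 * X := Nat.floor_le (by positivity)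
  let A : ℕ → Finset ℕ := fun d =>
    (Finset.Ioc 0 N).filter fun p : ℕ => p.Prime ∧ X ≤ p ∧ (p + d).Prime
  let B : Finset ℕ := (Finset.Ioc 0 N).filter fun p => p.Prime ∧ D < primeGap p
  let G' := G.filter fun d => 0 < d ∧ d ≤ D
  have hsub : {p ∈ dyadicPrimes X | primeGap p ≤ D → primeGap p ∈ G} ⊆
      ((G'.biUnion A ∪ B : Finset ℕ) : Set ℕ) := by
    rintro p ⟨⟨pp, h1, h2⟩, h3⟩
    have hs := primeGap_spec p pp
    have hpN : p ∈ Finset.Ioc 0 N := Finset.mem_Ioc.2 ⟨pp.pos, Nat.le_floor h2⟩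
    rw [Finset.mem_coe, Finset.mem_union]
    by_cases hpD : primeGap p ≤ D
    · refine Or.inl (Finset.mem_biUnion.2 ⟨primeGap p, ?_, ?_⟩)
      · exact Finset.mem_filter.2 ⟨h3 hpD, hs.1, hpD⟩
      · exact Finset.mem_filter.2 ⟨hpN, pp, h1, hs.2.1⟩
    · exact Or.inr (Finset.mem_filter.2 ⟨hpN, pp, not_le.1 hpD⟩)
  have hc := Set.ncard_le_ncard hsub (Finset.finite_toSet _)
  rw [Set.ncard_coe_finset] at hc
  have hc1 : ((G'.biUnion A).card : ℝ) ≤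
      G.card * (C * X * Real.log (Real.log X) ^ 18 / Real.log X ^ 2) := by
    calc ((G'.biUnion A).card : ℝ) ≤ ∑ d ∈ G', ((A d).card : ℝ) := by
          exact_mod_cast Finset.card_biUnion_le
      _ ≤ ∑ d ∈ G', (C * X * Real.log (Real.log X) ^ 18 / Real.log X ^ 2) :=
          Finset.sum_le_sum fun d hd =>
            hp d (Finset.mem_filter.1 hd).2.1 (Finset.mem_filter.1 hd).2.2
      _ = G'.card * (C * X * Real.log (Real.log X) ^ 18 / Real.log X ^ 2) := by
          rw [Finset.sum_const, nsmul_eq_mul]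
      _ ≤ _ := by
          gcongr
          exact Finset.filter_subset _ _
  have hc2 : (B.card : ℝ) ≤ 4 * X / Real.log X ^ 2 := by
    have h1 := sum_primeGap_le N B fun p hp => by
      have h := Finset.mem_filter.1 hp
      exact ⟨h.2.1, (Finset.mem_Ioc.1 h.1).2⟩
    have h2 : B.card * D ≤ ∑ p ∈ B, primeGap p := by
      rw [← smul_eq_mul]
      exact Finset.card_nsmul_le_sum _ _ _ fun p hp => (Finset.mem_filter.1 hp).2.2.le
    have h3 : (B.card : ℝ) * D ≤ 2 * N := by exact_mod_cast h2.trans h1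
    -- The factor `3` in the exponent of `D` suffices because `3 log 2 > 2`.
    have h4 : Real.log X ^ 2 ≤ D := by
      rw [hD]
      push_cast
      calc Real.log X ^ 2 = Real.exp ((2 : ℕ) * Real.log (Real.log X)) := by
            rw [Real.exp_nat_mul, Real.exp_log hY]
        _ ≤ Real.exp (⌈3 * Real.log (Real.log X)⌉₊ * Real.log 2) := by
            rw [Real.exp_le_exp]
            have e1 := Nat.le_ceil (3 * Real.log (Real.log X))
            have e2 := Real.log_two_gt_d9
            push_cast
            nlinarith
        _ = _ := by rw [Real.exp_nat_mul, Real.exp_log two_pos]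
    rw [le_div_iff₀ (by positivity)]
    calc (B.card : ℝ) * Real.log X ^ 2 ≤ B.card * D := by gcongr
      _ ≤ 4 * X := by linarith
  have hc3 : ((G'.biUnion A ∪ B).card : ℝ) ≤ (G'.biUnion A).card + B.card := by
    exact_mod_cast Finset.card_union_le _ _
  have hc4 : ({p ∈ dyadicPrimes X | primeGap p ≤ D → primeGap p ∈ G}.ncard : ℝ) ≤
      (G'.biUnion A ∪ B).card := by exact_mod_cast hc
  linarith

/-! ### Assembling the density bound. -/

/-- Rounding up costs a factor `2`, and replacing `log₂ X` by `2 log X` costs `2 ^ c ≤ 2`. -/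
theorem two_pow_ceil_mul_logb_logb_le {c X : ℝ} (hc0 : 0 < c) (hc1 : c < 1) (hX : Real.exp 1 ≤ X) :
    (2 : ℝ) ^ ⌈c * Real.logb 2 (Real.logb 2 X)⌉₊ ≤ 4 * Real.log X ^ c := by
  have hY : 1 ≤ Real.log X := (Real.le_log_iff_exp_le ((Real.exp_pos 1).trans_le hX)).2 hX
  have hl0 : 0.5 < Real.log 2 := by linarith [Real.log_two_gt_d9]
  have hl1 : Real.log 2 < 1 := by linarith [Real.log_two_lt_d9]
  have hb1 : 1 ≤ Real.logb 2 X := by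
    rw [Real.logb, le_div_iff₀ (by linarith)]; linarith
  have hb2 : Real.logb 2 X ≤ 2 * Real.log X := by
    rw [Real.logb, div_le_iff₀ (by linarith)]; nlinarith
  have hL : 0 ≤ c * Real.logb 2 (Real.logb 2 X) :=
    mul_nonneg hc0.le (Real.logb_nonneg one_lt_two hb1)
  have h1 := (Nat.ceil_lt_add_one hL).le
  calc (2 : ℝ) ^ ⌈c * Real.logb 2 (Real.logb 2 X)⌉₊
      ≤ 2 ^ (c * Real.logb 2 (Real.logb 2 X) + 1) := by
        rw [← Real.rpow_natCast]
        exact Real.rpow_le_rpow_of_exponent_le one_le_two h1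
    _ = 2 * Real.logb 2 X ^ c := by
        rw [Real.rpow_add two_pos, Real.rpow_one, mul_comm c, Real.rpow_mul two_pos.le,
          Real.rpow_logb two_pos (by norm_num) (by linarith), mul_comm]
    _ ≤ 2 * (2 * Real.log X) ^ c := by gcongr
    _ = 2 * (2 ^ c * Real.log X ^ c) := by
        rw [Real.mul_rpow two_pos.le (by linarith)]
    _ ≤ 2 * (2 ^ (1 : ℝ) * Real.log X ^ c) := by
        gcongr
        exact one_le_two
    _ = _ := by rw [Real.rpow_one]; ring

theorem eventually_log_pow_le_mul_rpow {c η : ℝ} (hc1 : c < 1) (hη : 0 < η) :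
    ∀ᶠ Y : ℝ in Filter.atTop, Real.log Y ^ 18 ≤ η * Y ^ (1 - c) := by
  have h := (isLittleO_log_rpow_rpow_atTop (18 : ℕ) (sub_pos.2 hc1)).bound hη
  filter_upwards [h, Filter.eventually_ge_atTop 0] with Y hY h0
  rw [Real.rpow_natCast, Real.norm_eq_abs, Real.norm_eq_abs,
    abs_of_nonneg (Real.rpow_nonneg h0 _)] at hY
  exact (le_abs_self _).trans hY

/-- Here `enc X` is the binary string by which the scale `X` is presented to the machine; the
claim is made for every choice of `enc`. -/
theorem mainTheorem1
    (U : List Bool → List Bool →. List Bool) (hU : IsUniversalPrefixFreeMachine U)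
    (code : ℕ → List Bool) (hcode : IsIntegerEncoding code)
    (enc : ℝ → List Bool)
    (c δ : ℝ) (hc0 : 0 < c) (hc1 : c < 1) (hδ0 : 0 < δ) (hδ1 : δ < 1) :
    ∃ X₀ : ℝ, ∀ X : ℝ, X₀ ≤ X →
      1 - δ ≤
        (Set.ncard {p ∈ dyadicPrimes X |
            c * Real.logb 2 (Real.logb 2 X) ≤
              (condKolmogorov U (code (primeGap p)) (enc X) : ℝ)} : ℝ) /
          (Set.ncard (dyadicPrimes X) : ℝ) := by
  obtain ⟨C, hC, hgap⟩ := eventually_ncard_primeGap_le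
  rw [← Filter.eventually_atTop]
  filter_upwards [hgap, eventually_le_ncard_dyadicPrimes,
    Filter.eventually_ge_atTop (Real.exp 1),
    Real.tendsto_log_atTop.eventually_ge_atTop (128 / δ),
    Real.tendsto_log_atTop.eventually (eventually_log_pow_le_mul_rpow (η := δ / (128 * C)) hc1
      (by positivity))] with X hgap hden hX hYδ hl
  set k := ⌈c * Real.logb 2 (Real.logb 2 X)⌉₊ with hk
  set Y := Real.log X with hY
  have hX0 : 0 < X := (Real.exp_pos 1).trans_le hX
  have hY0 : 0 < Y := lt_of_lt_of_le (by positivity) hYδ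
  let G : Finset ℕ := (Finset.range (2 ^ ⌈3 * Real.log Y⌉₊ + 1)).filter fun d =>
    condKolmogorov U (code d) (enc X) < k
  have hG : (G.card : ℝ) ≤ 4 * Y ^ c := by
    have h1 := card_le_of_condKolmogorov_lt hU hcode.injective (enc X) k G
      fun d hd => (Finset.mem_filter.1 hd).2
    have h2 : (G.card : ℝ) ≤ 2 ^ k := by exact_mod_cast h1
    exact h2.trans (two_pow_ceil_mul_logb_logb_le hc0 hc1 hX)
  set good := {p ∈ dyadicPrimes X | c * Real.logb 2 (Real.logb 2 X) ≤
    (condKolmogorov U (code (primeGap p)) (enc X) : ℝ)}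
  set bad := {p ∈ dyadicPrimes X | primeGap p ≤ 2 ^ ⌈3 * Real.log Y⌉₊ → primeGap p ∈ G}
  have hcover : dyadicPrimes X ⊆ good ∪ bad := by
    intro p hp
    by_cases h : c * Real.logb 2 (Real.logb 2 X) ≤
        (condKolmogorov U (code (primeGap p)) (enc X) : ℝ)
    · exact Or.inl ⟨hp, h⟩
    · refine Or.inr ⟨hp, fun hle => ?_⟩
      refine Finset.mem_filter.2 ⟨Finset.mem_range.2 (Nat.lt_succ_of_le hle), ?_⟩
      exact_mod_cast (not_le.1 h).trans_le (Nat.le_ceil _)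
  have hfin := dyadicPrimes_finite X
  have hcard : ((dyadicPrimes X).ncard : ℝ) ≤ good.ncard + bad.ncard := by
    have h1 := Set.ncard_le_ncard hcover
      ((hfin.subset (Set.sep_subset _ _)).union (hfin.subset (Set.sep_subset _ _)))
    exact_mod_cast h1.trans (Set.ncard_union_le _ _)
  -- The thresholds `δ / (128 C)` and `128 / δ` are chosen so that simple gaps and large gaps each
  -- contribute at most `δ X / (32 Y)`.
  have hbad : (bad.ncard : ℝ) ≤ δ * (X / (16 * Y)) := by
    have hYY : Y ^ c * Y ^ (1 - c) = Y := by
      rw [← Real.rpow_add hY0]; simp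
    have h4 : 4 ≤ δ * Y / 32 := by
      rw [div_le_iff₀ hδ0] at hYδ
      linarith
    calc (bad.ncard : ℝ) ≤ G.card * (C * X * Real.log Y ^ 18 / Y ^ 2) + 4 * X / Y ^ 2 := hgap G
      _ ≤ (4 * Y ^ c) * (C * X * (δ / (128 * C) * Y ^ (1 - c)) / Y ^ 2) +
          (δ * Y / 32) * X / Y ^ 2 := by gcongr
      _ = (Y ^ c * Y ^ (1 - c)) * (δ * X / (32 * Y ^ 2)) + (δ * Y / 32) * X / Y ^ 2 := by
          field_simp
          ring
      _ = δ * (X / (16 * Y)) := by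
          rw [hYY]
          field_simp
          ring
  have htot : 0 < ((dyadicPrimes X).ncard : ℝ) := lt_of_lt_of_le (by positivity) hden
  have hbad' : (bad.ncard : ℝ) ≤ δ * (dyadicPrimes X).ncard := hbad.trans (by gcongr)
  rw [le_div_iff₀ htot]
  linarith
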